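/- Let $d\ge 2$ be an integer and let $$G(X)=\sum_{n=0}^\infty A_nX^n\in\mathbb{C}[[X]]$$ be a formal power series. Suppose that $h(X,G(X))=0$ for some irreducible polynomial $h(X,Y)\in\mathbb{C}[X,Y]$ of total degree at most $d$. Then there are an integer $L\ge 0$ and polynomials $P_0,\dots,P_L\in\mathbb{C}[T]$, with $P_L$ not the zero polynomial, such that $$\sum_{j=0}^{L}A_{n+j}\,P_j(n)=0\qquad\text{for all } n=0,1,2,\dots,$$ and $$L\le 4d^2\qquad\text{and}\qquad \deg P_j\le 3(d+1)^2\quad\text{for } j=0,\dots,L.$$ -/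

import Mathlib

namespace MvPolynomial

/-! Let `θ = X d/dX` and let `q` be a nonzero polynomial of degree `e ≤ d` with `q(X,G) = 0` and `D
= q_Y(X,G) ≠ 0`. Since `DθG = -X q_X(X,G)`, each `D^(2r) X^i θ^k G` with `i ≤ L`, `k ≤ r` is a
polynomial in `X, G` of degree at most `N = L + 1 + (2e+1)r`. Such values span dimension at most
`e(N+1)`, linear in `N` (`finrank_valuesOfDegreeLE_le`), whereas there are `(L+1)(r+1)` pairs
`(i,k)`. For suitable `L, r` this forces a relation `∑ X^i p_i(θ) G = 0`, whose coefficients give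
the recurrence. -/

theorem totalDegree_pderiv_le {σ R : Type*} [CommSemiring R] (i : σ)
    (p : MvPolynomial σ R) : (pderiv i p).totalDegree ≤ p.totalDegree - 1 := by
  refine Finset.sup_le fun m hm => ?_
  have hm' : m + Finsupp.single i 1 ∈ p.support := by
    rw [mem_support_iff, coeff_pderiv] at hm
    exact mem_support_iff.2 (left_ne_zero_of_mul hm)
  have := le_totalDegree hm'
  rw [Finsupp.sum_add_index' (fun _ => rfl) (fun _ _ _ => rfl),
    Finsupp.sum_single_index rfl] at this
  omega

theorem totalDegree_pderiv_lt {σ R : Type*} [CommSemiring R] {i : σ}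
    {p : MvPolynomial σ R} (h : pderiv i p ≠ 0) :
    (pderiv i p).totalDegree < p.totalDegree := by
  have h1 := totalDegree_pderiv_le i p
  rcases Nat.eq_zero_or_pos p.totalDegree with h0 | h0
  · rw [totalDegree_eq_zero_iff_eq_C] at h0
    rw [h0, pderiv_C] at h
    exact absurd rfl h
  · omega

theorem eq_C_of_forall_pderiv_eq_zero {σ R : Type*} [CommRing R] [IsDomain R] [CharZero R]
    {p : MvPolynomial σ R} (h : ∀ i, pderiv i p = 0) : p = C (coeff 0 p) := by
  rw [← totalDegree_eq_zero_iff_eq_C, totalDegree_eq_zero_iff]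
  intro m hm i
  by_contra hi
  have h1 := coeff_pderiv (i := i) p (m - Finsupp.single i 1)
  have h2 : Finsupp.single i 1 ≤ m := by
    rw [Finsupp.single_le_iff]; omega
  rw [h i, coeff_zero, tsub_add_cancel_of_le h2] at h1
  exact mul_ne_zero (mem_support_iff.1 hm) (Nat.cast_add_one_ne_zero _) h1.symm

theorem finrank_restrictTotalDegree_le (K : Type*) [Field K] {M N e : ℕ} (h : N = M + e) :
    Module.finrank K (restrictTotalDegree (Fin 2) K N) ≤
      Module.finrank K (restrictTotalDegree (Fin 2) K M) + e * (N + 1) := by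
  have key (n : ℕ) : Module.finrank K (restrictTotalDegree (Fin 2) K n) =
      {s : Fin 2 →₀ ℕ | (s.sum fun _ a => a) ≤ n}.ncard :=
    Module.finrank_eq_nat_card_basis
      (basisRestrictSupport K {s : Fin 2 →₀ ℕ | (s.sum fun _ a => a) ≤ n})
  have hsum (s : Fin 2 →₀ ℕ) : (s.sum fun _ a => a) = s 0 + s 1 := by
    rw [Finsupp.sum_fintype _ _ (fun _ => rfl), Fin.sum_univ_two]
  simp only [key, hsum]
  have hinj : Function.Injective fun s : Fin 2 →₀ ℕ => (s 0, s 1) := by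
    intro s t hst
    ext i
    fin_cases i
    · exact (Prod.ext_iff.1 hst).1
    · exact (Prod.ext_iff.1 hst).2
  have hfin (n : ℕ) : {s : Fin 2 →₀ ℕ | s 0 + s 1 ≤ n}.Finite := by
    refine Set.Finite.of_finite_image (f := fun s : Fin 2 →₀ ℕ => (s 0, s 1))
      (Set.Finite.subset (Finset.finite_toSet (Finset.range (n + 1) ×ˢ Finset.range (n + 1))) ?_)
      hinj.injOn
    rintro _ ⟨s, hs, rfl⟩
    simp only [Set.mem_ofPred_eq] at hs
    simp only [Finset.coe_product, Finset.coe_range, Set.mem_prod, Set.mem_Iio]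
    omega
  have hdiff : ({s : Fin 2 →₀ ℕ | s 0 + s 1 ≤ N} \ {s : Fin 2 →₀ ℕ | s 0 + s 1 ≤ M}).ncard ≤
      (↑(Finset.range e ×ˢ Finset.range (N + 1)) : Set (ℕ × ℕ)).ncard := by
    -- The defect `N - (s 0 + s 1)` is below `e` because the total exceeds `M = N - e`.
    refine Set.ncard_le_ncard_of_injOn (fun s => (N - (s 0 + s 1), s 0)) ?_ ?_
      (Finset.finite_toSet _)
    · rintro s ⟨h1, h2⟩
      simp only [Set.mem_ofPred_eq] at h1 h2
      simp only [Finset.coe_product, Finset.coe_range, Set.mem_prod, Set.mem_Iio]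
      omega
    · rintro s ⟨h1, h2⟩ t ⟨h3, h4⟩ hst
      simp only [Set.mem_ofPred_eq, Prod.mk.injEq] at h1 h3 hst
      refine hinj ?_
      simp only [Prod.mk.injEq]
      omega
  rw [Set.ncard_coe_finset, Finset.card_product, Finset.card_range, Finset.card_range] at hdiff
  have := Set.ncard_le_ncard_sdiff_add_ncard {s : Fin 2 →₀ ℕ | s 0 + s 1 ≤ N}
    {s : Fin 2 →₀ ℕ | s 0 + s 1 ≤ M} (hfin M)
  omega

/-! ### Values of polynomials of bounded degree -/

variable {σ K A : Type*} [Field K] [CommRing A] [Algebra K A]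

/-- The values at `v` of the polynomials of total degree at most `N`. -/
noncomputable def valuesOfDegreeLE (v : σ → A) (N : ℕ) : Submodule K A :=
  (restrictTotalDegree σ K N).map (aeval v).toLinearMap

theorem mem_valuesOfDegreeLE {v : σ → A} {N : ℕ} {a : A} :
    a ∈ valuesOfDegreeLE (K := K) v N ↔
      ∃ p : MvPolynomial σ K, p.totalDegree ≤ N ∧ aeval v p = a := by
  simp [valuesOfDegreeLE, Submodule.mem_map, mem_restrictTotalDegree]

instance [Finite σ] (v : σ → A) (N : ℕ) : Module.Finite K (valuesOfDegreeLE (K := K) v N) := by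
  unfold valuesOfDegreeLE
  infer_instance

theorem valuesOfDegreeLE_mono (v : σ → A) : Monotone (valuesOfDegreeLE (K := K) v) := by
  intro m n h a ha
  rw [mem_valuesOfDegreeLE] at ha ⊢
  obtain ⟨p, hp, rfl⟩ := ha
  exact ⟨p, hp.trans h, rfl⟩

theorem mul_mem_valuesOfDegreeLE {v : σ → A} {m n : ℕ} {a b : A}
    (ha : a ∈ valuesOfDegreeLE (K := K) v m) (hb : b ∈ valuesOfDegreeLE (K := K) v n) :
    a * b ∈ valuesOfDegreeLE (K := K) v (m + n) := by
  rw [mem_valuesOfDegreeLE] at ha hb ⊢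
  obtain ⟨p, hp, rfl⟩ := ha
  obtain ⟨q, hq, rfl⟩ := hb
  exact ⟨p * q, (totalDegree_mul p q).trans (add_le_add hp hq), map_mul _ _ _⟩

theorem pow_mem_valuesOfDegreeLE {v : σ → A} {m : ℕ} {a : A}
    (ha : a ∈ valuesOfDegreeLE (K := K) v m) (k : ℕ) :
    a ^ k ∈ valuesOfDegreeLE (K := K) v (m * k) := by
  induction k with
  | zero => exact mem_valuesOfDegreeLE.2 ⟨1, by simp, by simp⟩
  | succ k ih => rw [pow_succ]; exact mul_mem_valuesOfDegreeLE ih ha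

theorem apply_mem_valuesOfDegreeLE (v : σ → A) (i : σ) :
    v i ∈ valuesOfDegreeLE (K := K) v 1 :=
  mem_valuesOfDegreeLE.2 ⟨X i, by simp, by simp⟩

/-- Evaluation kills every multiple `h * q` with `deg q ≤ N - deg h`, so only the difference of two
full dimensions survives. -/
theorem finrank_valuesOfDegreeLE_le {v : Fin 2 → A} {h : MvPolynomial (Fin 2) K} (h0 : h ≠ 0)
    (hv : aeval v h = 0) {N : ℕ} (hN : h.totalDegree ≤ N) :
    Module.finrank K (valuesOfDegreeLE (K := K) v N) ≤ h.totalDegree * (N + 1) := by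
  obtain ⟨M, rfl⟩ := Nat.exists_eq_add_of_le' hN
  set N := M + h.totalDegree with hNM
  let f := (aeval v).toLinearMap.domRestrict (restrictTotalDegree (Fin 2) K N)
  have hrange : LinearMap.range f = valuesOfDegreeLE v N := LinearMap.range_domRestrict _ _
  have hmem (q : MvPolynomial (Fin 2) K) (hq : q ∈ restrictTotalDegree (Fin 2) K M) :
      h * q ∈ restrictTotalDegree (Fin 2) K N := by
    rw [mem_restrictTotalDegree] at hq ⊢
    have := totalDegree_mul h q
    omega
  let g : restrictTotalDegree (Fin 2) K M →ₗ[K] LinearMap.ker f :=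
    (((LinearMap.mulLeft K h).domRestrict _).codRestrict _ fun q => hmem q q.2).codRestrict _
      fun q => by
        change aeval v (h * (q : MvPolynomial (Fin 2) K)) = 0
        rw [map_mul, hv, zero_mul]
  have hg : Function.Injective g := by
    intro p q hpq
    have h1 : h * (p : MvPolynomial (Fin 2) K) = h * q :=
      congrArg (fun x : LinearMap.ker f => ((x : restrictTotalDegree (Fin 2) K N) :
        MvPolynomial (Fin 2) K)) hpq
    exact Subtype.ext (mul_left_cancel₀ h0 h1)
  have h1 := LinearMap.finrank_le_finrank_of_injective hg
  have h2 := f.finrank_range_add_finrank_ker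
  have h3 := finrank_restrictTotalDegree_le K hNM
  rw [hrange] at h2
  omega

theorem derivation_aeval {v : σ → A} [Fintype σ] (θ : Derivation K A A) (p : MvPolynomial σ K) :
    θ (aeval v p) = ∑ i, aeval v (pderiv i p) * θ (v i) := by
  classical
  induction p using MvPolynomial.induction_on with
  | C a => simp
  | add p q hp hq => simp [hp, hq, add_mul, Finset.sum_add_distrib]
  | mul_X p i hp =>
    simp only [map_mul, aeval_X, Derivation.leibniz, hp, smul_eq_mul, map_add, pderiv_X, add_mul,
      Finset.sum_add_distrib, Finset.mul_sum]
    congr 1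
    · simp [Pi.single_apply, apply_ite]
    · exact Finset.sum_congr rfl fun j _ => by ring

section Derivation

variable [Fintype σ] {v : σ → A} {θ : Derivation K A A} {D : A} {e : ℕ}

theorem mul_derivation_mem_valuesOfDegreeLE
    (hθ : ∀ i, D * θ (v i) ∈ valuesOfDegreeLE (K := K) v e) {n : ℕ} {a : A}
    (ha : a ∈ valuesOfDegreeLE (K := K) v n) :
    D * θ a ∈ valuesOfDegreeLE (K := K) v (n + e) := by
  obtain ⟨p, hp, rfl⟩ := mem_valuesOfDegreeLE.1 ha
  rw [derivation_aeval, Finset.mul_sum]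
  refine Submodule.sum_mem _ fun i _ => ?_
  rw [mul_left_comm]
  refine mul_mem_valuesOfDegreeLE (mem_valuesOfDegreeLE.2 ⟨_, ?_, rfl⟩) (hθ i)
  exact (totalDegree_pderiv_le i p).trans ((Nat.sub_le _ _).trans hp)

/-- Each `θ` costs two factors `D`: one makes `θ` of a value a value again, the other absorbs the `θ
D` term of the Leibniz rule. -/
theorem pow_mul_iterate_derivation_mem_valuesOfDegreeLE
    (hD : D ∈ valuesOfDegreeLE (K := K) v e)
    (hθ : ∀ i, D * θ (v i) ∈ valuesOfDegreeLE (K := K) v (e + 1)) (i : σ) (k : ℕ) :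
    D ^ (2 * k) * ((θ : A →ₗ[K] A) ^ k) (v i) ∈
      valuesOfDegreeLE (K := K) v (1 + (2 * e + 1) * k) := by
  induction k with
  | zero => simpa using apply_mem_valuesOfDegreeLE v i
  | succ k ih =>
    rw [pow_succ', Module.End.mul_apply]
    set u := ((θ : A →ₗ[K] A) ^ k) (v i)
    have h1 := mul_mem_valuesOfDegreeLE hD (mul_derivation_mem_valuesOfDegreeLE hθ ih)
    have h2 := mul_mem_valuesOfDegreeLE (mul_derivation_mem_valuesOfDegreeLE hθ hD) ih
    have h3 : D ^ (2 * (k + 1)) * θ u =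
        D * (D * θ (D ^ (2 * k) * u)) - ((2 * k : ℕ) : K) • (D * θ D * (D ^ (2 * k) * u)) := by
      rcases k with _ | k
      · simp; ring
      · rw [Derivation.leibniz, Derivation.leibniz_pow, Nat.cast_smul_eq_nsmul,
          show 2 * (k + 1) - 1 = 2 * k + 1 by omega]
        simp only [smul_eq_mul, nsmul_eq_mul]
        ring
    rw [Derivation.coeFn_coe, h3]
    refine Submodule.sub_mem _ (valuesOfDegreeLE_mono v ?_ h1)
      (Submodule.smul_mem _ _ (valuesOfDegreeLE_mono v ?_ h2)) <;> nlinarith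

theorem pow_mul_aeval_derivation_mem_valuesOfDegreeLE
    (hD : D ∈ valuesOfDegreeLE (K := K) v e)
    (hθ : ∀ i, D * θ (v i) ∈ valuesOfDegreeLE (K := K) v (e + 1)) (i : σ) {r : ℕ}
    {p : Polynomial K} (hp : p.natDegree ≤ r) :
    D ^ (2 * r) * Polynomial.aeval (θ : Module.End K A) p (v i) ∈
      valuesOfDegreeLE (K := K) v (1 + (2 * e + 1) * r) := by
  rw [Polynomial.aeval_eq_sum_range, LinearMap.sum_apply, Finset.mul_sum]
  refine Submodule.sum_mem _ fun k hk => ?_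
  have hk : k ≤ r := (Nat.lt_succ_iff.1 (Finset.mem_range.1 hk)).trans hp
  obtain ⟨l, rfl⟩ := Nat.exists_eq_add_of_le hk
  -- With `r = k + l`, the spare `D ^ (2 * l)` adds degree `2el ≤ (2e+1)l`.
  rw [LinearMap.smul_apply, mul_smul_comm, add_comm k, mul_add 2, pow_add, mul_assoc]
  refine Submodule.smul_mem _ _ (valuesOfDegreeLE_mono v ?_ (mul_mem_valuesOfDegreeLE
    (pow_mem_valuesOfDegreeLE hD (2 * l))
    (pow_mul_iterate_derivation_mem_valuesOfDegreeLE hD hθ i k)))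
  nlinarith

end Derivation

end MvPolynomial

/-! ### Differential equation and recurrence -/

namespace PowerSeries

variable {K : Type*} [Field K]

/-- `θ` scales `X^n` by `n`; this turns the differential equation into a recurrence. -/
theorem coeff_aeval_X_smul_derivative (p : Polynomial K) (G : PowerSeries K) (n : ℕ) :
    coeff n (Polynomial.aeval (((X : PowerSeries K) • derivative K :
      Derivation K (PowerSeries K) (PowerSeries K)) : Module.End K (PowerSeries K)) p G) =
      p.eval (n : K) * coeff n G := by
  set θ : Module.End K (PowerSeries K) := (((X : PowerSeries K) • derivative K :
      Derivation K (PowerSeries K) (PowerSeries K)) : Module.End K (PowerSeries K)) with hθ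
  have h1 (f : PowerSeries K) : coeff n (θ f) = n * coeff n f := by
    change coeff n (X * derivative K f) = _
    rcases n with _ | n
    · simp
    · rw [coeff_succ_X_mul, coeff_derivative]; push_cast; ring
  have h2 (k : ℕ) : coeff n ((θ ^ k) G) = (n : K) ^ k * coeff n G := by
    induction k with
    | zero => simp
    | succ k ih => rw [pow_succ', Module.End.mul_apply, h1, ih]; ring
  rw [Polynomial.aeval_eq_sum_range, LinearMap.sum_apply, map_sum, Polynomial.eval_eq_sum_range,
    Finset.sum_mul]
  refine Finset.sum_congr rfl fun k _ => ?_
  rw [LinearMap.smul_apply, coeff_smul, h2, smul_eq_mul, mul_assoc]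

open MvPolynomial in
/-- Among the nonzero polynomials vanishing at `(X, G)`, one of least total degree has a partial
derivative in the second variable that does not vanish there. -/
theorem exists_annihilator_aeval_pderiv_ne_zero [CharZero K] {G : PowerSeries K}
    {h : MvPolynomial (Fin 2) K} (h0 : h ≠ 0) (hG : MvPolynomial.aeval ![(X : PowerSeries K), G] h = 0) :
    ∃ q : MvPolynomial (Fin 2) K, q ≠ 0 ∧ q.totalDegree ≤ h.totalDegree ∧
      MvPolynomial.aeval ![(X : PowerSeries K), G] q = 0 ∧
      MvPolynomial.aeval ![(X : PowerSeries K), G] (pderiv 1 q) ≠ 0 := by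
  induction hn : h.totalDegree using Nat.strong_induction_on generalizing h with
  | _ n ih =>
    subst hn
    have descend (i : Fin 2) (hi : MvPolynomial.aeval ![(X : PowerSeries K), G] (pderiv i h) = 0)
        (hne : pderiv i h ≠ 0) : ∃ q : MvPolynomial (Fin 2) K, q ≠ 0 ∧
          q.totalDegree ≤ h.totalDegree ∧ MvPolynomial.aeval ![(X : PowerSeries K), G] q = 0 ∧
          MvPolynomial.aeval ![(X : PowerSeries K), G] (pderiv 1 q) ≠ 0 := by
      have hlt := totalDegree_pderiv_lt hne
      obtain ⟨q, hq0, hq, hq'⟩ := ih _ hlt hne hi rfl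
      exact ⟨q, hq0, hq.trans hlt.le, hq'⟩
    by_cases hY : MvPolynomial.aeval ![(X : PowerSeries K), G] (pderiv 1 h) = 0
    · by_cases hY0 : pderiv 1 h = 0
      -- Differentiating `h(X,G) = 0` gives `h_X + h_Y G' = 0`, and here `h_Y = 0`.
      · have hX : MvPolynomial.aeval ![(X : PowerSeries K), G] (pderiv 0 h) = 0 := by
          have := derivation_aeval (v := ![(X : PowerSeries K), G]) (derivative K) h
          rw [hG] at this
          simpa [Fin.sum_univ_two, hY] using this.symm
        by_cases hX0 : pderiv 0 h = 0
        · have hC := eq_C_of_forall_pderiv_eq_zero (p := h) (by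
            intro i; fin_cases i
            · exact hX0
            · exact hY0)
          rw [hC, MvPolynomial.aeval_C, FaithfulSMul.algebraMap_eq_zero_iff] at hG
          rw [hG, C_0] at hC
          exact absurd hC h0
        · exact descend 0 hX hX0
      · exact descend 1 hY hY0
    · exact ⟨h, h0, le_rfl, hG, hY⟩

open MvPolynomial in
/-- A nontrivial differential equation in the Euler derivation, obtained by counting dimensions. -/
theorem exists_sum_X_pow_mul_aeval_eq_zero {G : PowerSeries K}
    {q : MvPolynomial (Fin 2) K} (q0 : q ≠ 0) (hG : MvPolynomial.aeval ![(X : PowerSeries K), G] q = 0)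
    (hq : MvPolynomial.aeval ![(X : PowerSeries K), G] (pderiv 1 q) ≠ 0) {L r : ℕ}
    (hL : q.totalDegree * (L + 2 + (2 * q.totalDegree + 1) * r) < (L + 1) * (r + 1)) :
    ∃ p : Fin (L + 1) → Polynomial K, p ≠ 0 ∧ (∀ i, (p i).natDegree ≤ r) ∧
      ∑ i : Fin (L + 1), X ^ (i : ℕ) * Polynomial.aeval (((X : PowerSeries K) • derivative K :
        Derivation K (PowerSeries K) (PowerSeries K)) : Module.End K (PowerSeries K)) (p i) G
        = 0 := by
  set v := ![(X : PowerSeries K), G] with hv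
  set e := q.totalDegree with he
  set D := MvPolynomial.aeval v (pderiv 1 q)
  set θ : Derivation K (PowerSeries K) (PowerSeries K) := (X : PowerSeries K) • derivative K
    with hθ
  have hX : (X : PowerSeries K) ∈ valuesOfDegreeLE (K := K) v 1 := apply_mem_valuesOfDegreeLE v 0
  have hpd (i : Fin 2) : MvPolynomial.aeval v (pderiv i q) ∈ valuesOfDegreeLE (K := K) v e :=
    mem_valuesOfDegreeLE.2 ⟨_, (totalDegree_pderiv_le i q).trans (Nat.sub_le _ _), rfl⟩
  have hD : D ∈ valuesOfDegreeLE (K := K) v e := hpd 1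
  have hθv (i : Fin 2) : D * θ (v i) ∈ valuesOfDegreeLE (K := K) v (e + 1) := by
    fin_cases i
    · have : θ X = X := by simp [hθ]
      change D * θ X ∈ _
      rw [this]
      exact mul_mem_valuesOfDegreeLE hD hX
    · have h1 := derivation_aeval (v := v) θ q
      rw [hG, map_zero, Fin.sum_univ_two] at h1
      have h2 : D * θ (v 1) = -(MvPolynomial.aeval v (pderiv 0 q) * θ (v 0)) := by
        linear_combination -h1
      have : θ (v 0) = X := by simp [hθ, hv]
      change D * θ (v 1) ∈ _
      rw [h2, this]
      exact Submodule.neg_mem _ (mul_mem_valuesOfDegreeLE (hpd 0) hX)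
  set N := L + 1 + (2 * e + 1) * r with hN
  let Φ : (Fin (L + 1) → Polynomial.degreeLT K (r + 1)) →ₗ[K] PowerSeries K :=
    ∑ i : Fin (L + 1), LinearMap.mulLeft K (D ^ (2 * r) * X ^ (i : ℕ)) ∘ₗ
      LinearMap.applyₗ G ∘ₗ (Polynomial.aeval (θ : Module.End K (PowerSeries K))).toLinearMap ∘ₗ
      (Polynomial.degreeLT K (r + 1)).subtype ∘ₗ LinearMap.proj i
  have hΦ (p) : Φ p = D ^ (2 * r) * ∑ i : Fin (L + 1), X ^ (i : ℕ) *
      Polynomial.aeval (θ : Module.End K (PowerSeries K)) (p i : Polynomial K) G := by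
    simp [Φ, Finset.mul_sum]
  have hdeg (p : Polynomial.degreeLT K (r + 1)) : (p : Polynomial K).natDegree ≤ r :=
    Polynomial.natDegree_le_iff_coeff_eq_zero.2 fun k hk =>
      (Polynomial.degree_lt_iff_coeff_zero _ _).1 (Polynomial.mem_degreeLT.1 p.2) k hk
  have hmem (p) : Φ p ∈ valuesOfDegreeLE (K := K) v N := by
    rw [hΦ, Finset.mul_sum]
    refine Submodule.sum_mem _ fun i _ => ?_
    rw [mul_left_comm]
    refine valuesOfDegreeLE_mono v ?_ (mul_mem_valuesOfDegreeLE (pow_mem_valuesOfDegreeLE hX i)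
      (pow_mul_aeval_derivation_mem_valuesOfDegreeLE hD hθv 1 (hdeg (p i))))
    have := i.2
    omega
  have hker : LinearMap.ker (Φ.codRestrict _ hmem) ≠ ⊥ := by
    refine LinearMap.ker_ne_bot_of_finrank_lt ?_
    -- For `r = 0` and `e > 0`, `hL` is contradictory.
    have hN' : e ≤ N := by
      rcases Nat.eq_zero_or_pos e with h0 | h0
      · omega
      · rcases Nat.eq_zero_or_pos r with rfl | h1 <;> nlinarith
    have h1 := finrank_valuesOfDegreeLE_le q0 hG (N := N) hN'
    have h2 : Module.finrank K (Fin (L + 1) → Polynomial.degreeLT K (r + 1)) =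
        (L + 1) * (r + 1) := by
      rw [Module.finrank_pi_fintype]
      simp [Module.finrank_eq_card_basis (Polynomial.degreeLT.basis K (r + 1))]
    rw [h2]
    refine h1.trans_lt (lt_of_eq_of_lt ?_ hL)
    rw [hN]; ring
  obtain ⟨p, hp, hp0⟩ := Submodule.exists_mem_ne_zero_of_ne_bot hker
  have hp' : Φ p = 0 := congrArg Subtype.val hp
  rw [hΦ] at hp'
  refine ⟨fun i => p i, fun h => hp0 ?_, fun i => hdeg _,
    (mul_eq_zero.1 hp').resolve_left (pow_ne_zero _ hq)⟩
  funext i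
  exact Subtype.ext (congrFun h i)

/-- Trimming the zero polynomials at the end of a recurrence. -/
theorem exists_recurrence_last_ne_zero {a : ℕ → K} {L r : ℕ} {Q : ℕ → Polynomial K}
    (hQ : ∃ j ≤ L, Q j ≠ 0) (hr : ∀ j, (Q j).natDegree ≤ r)
    (h : ∀ n, ∑ j ∈ Finset.range (L + 1), a (n + j) * (Q j).eval (n : K) = 0) :
    ∃ (M : ℕ) (P : Fin (M + 1) → Polynomial K), M ≤ L ∧ (∀ j, (P j).natDegree ≤ r) ∧
      P (Fin.last M) ≠ 0 ∧ ∀ n, ∑ j : Fin (M + 1), a (n + j) * (P j).eval (n : K) = 0 := by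
  induction L with
  | zero =>
    obtain ⟨j, hj, hj'⟩ := hQ
    obtain rfl : j = 0 := by omega
    refine ⟨0, fun j => Q j, le_rfl, fun j => hr j, hj', fun n => ?_⟩
    rw [← h n, Finset.sum_range]
  | succ L ih =>
    by_cases hL : Q (L + 1) = 0
    · obtain ⟨j, hj, hj'⟩ := hQ
      have : j ≠ L + 1 := by rintro rfl; exact hj' hL
      obtain ⟨M, P, hM, hP⟩ := ih ⟨j, by omega, hj'⟩ fun n => by
        have := h n
        rwa [Finset.sum_range_succ, hL, Polynomial.eval_zero, mul_zero, add_zero] at this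
      exact ⟨M, P, hM.trans (Nat.le_succ L), hP⟩
    · refine ⟨L + 1, fun j => Q j, le_rfl, fun j => hr j, by simpa using hL, fun n => ?_⟩
      rw [← h n, Finset.sum_range]

end PowerSeries

theorem proposition2p1 (d : ℕ) (hd : 2 ≤ d) (G : PowerSeries ℂ)
    (h : MvPolynomial (Fin 2) ℂ) (hirr : Irreducible h) (hdeg : h.totalDegree ≤ d)
    (hG : MvPolynomial.aeval ![(PowerSeries.X : PowerSeries ℂ), G] h = 0) :
    ∃ (L : ℕ) (P : Fin (L + 1) → Polynomial ℂ),
      L ≤ 4 * d ^ 2 ∧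
      (∀ j, (P j).natDegree ≤ 3 * (d + 1) ^ 2) ∧
      P (Fin.last L) ≠ 0 ∧
      ∀ n : ℕ, ∑ j : Fin (L + 1),
        PowerSeries.coeff (n + (j : ℕ)) G * (P j).eval (n : ℂ) = 0 := by
  obtain ⟨q, q0, hqd, hqG, hqD⟩ :=
    PowerSeries.exists_annihilator_aeval_pderiv_ne_zero hirr.ne_zero hG
  -- Here `L = 4d²`, `r = 3(d+1)²`: the leading terms are `6d⁴` against `12d⁴`.
  have hcount : q.totalDegree * (4 * d ^ 2 + 2 + (2 * q.totalDegree + 1) * (3 * (d + 1) ^ 2)) <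
      (4 * d ^ 2 + 1) * (3 * (d + 1) ^ 2 + 1) := by
    have hq : q.totalDegree ≤ d := hqd.trans hdeg
    calc _ ≤ d * (4 * d ^ 2 + 2 + (2 * d + 1) * (3 * (d + 1) ^ 2)) := by gcongr
      _ < _ := by
        obtain ⟨c, rfl⟩ := Nat.exists_eq_add_of_le hd
        ring_nf
        nlinarith [Nat.zero_le c, Nat.zero_le (c ^ 2), Nat.zero_le (c ^ 3), Nat.zero_le (c ^ 4)]
  set L := 4 * d ^ 2
  obtain ⟨p, hp0, hpr, hp⟩ :=
    PowerSeries.exists_sum_X_pow_mul_aeval_eq_zero q0 hqG hqD hcount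
  let p' : ℕ → Polynomial ℂ := fun i => if hi : i < L + 1 then p ⟨i, hi⟩ else 0
  have hp' (i : Fin (L + 1)) : p' i = p i := dif_pos i.2
  have hp'r (i : ℕ) : (p' i).natDegree ≤ 3 * (d + 1) ^ 2 := by
    by_cases hi : i < L + 1
    · exact (congrArg _ (dif_pos hi)).trans_le (hpr _)
    · exact (congrArg _ (dif_neg hi)).trans_le (Nat.zero_le _)
  -- In the coefficient of `X^(n+L)`, the `i`-th term is `p_i(n+L-i) A_{n+L-i}`; substitute `j = L -
  -- i`. As `i ≤ n + L`, no term drops out, even at `n = 0`.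
  refine PowerSeries.exists_recurrence_last_ne_zero (a := fun n => PowerSeries.coeff n G)
    (Q := fun j => (p' (L - j)).comp (Polynomial.X + Polynomial.C (j : ℂ))) ?_ ?_ ?_
  · obtain ⟨i, hi⟩ := Function.ne_iff.1 hp0
    refine ⟨L - i, Nat.sub_le _ _, ?_⟩
    rw [Nat.sub_sub_self (Nat.lt_succ_iff.1 i.2), hp', Ne, Polynomial.comp_X_add_C_eq_zero_iff]
    exact hi
  · intro j
    rw [Polynomial.natDegree_comp, Polynomial.natDegree_X_add_C, mul_one]
    exact hp'r _
  · intro n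
    have h1 := congrArg (PowerSeries.coeff (n + L)) hp
    simp only [map_sum, map_zero, PowerSeries.coeff_X_pow_mul'] at h1
    rw [← h1, ← Finset.sum_range_reflect, ← Fin.sum_univ_eq_sum_range]
    refine Finset.sum_congr rfl fun i _ => ?_
    have hi : (i : ℕ) ≤ L := Nat.lt_succ_iff.1 i.2
    rw [if_pos (by omega), PowerSeries.coeff_aeval_X_smul_derivative, ← hp',
      show L + 1 - 1 - (i : ℕ) = L - i by omega, Nat.sub_sub_self hi,
      show n + L - (i : ℕ) = n + (L - i) by omega]
    simp [mul_comm]
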